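/- Let $H$ be a finite simple graph that is chordal (it has no induced cycle $C_m$ with $m \ge 4$) and has clique number $\omega(H) = 3$. Then its $2$-clique-relaxed game chromatic number satisfies $$\chi_{\mathrm g}^{(2)}(H) \le 4 .$$ Here, in the $k$-clique-relaxed coloring game on a finite graph $G$ with a fixed set of $n$ colors, Alice and Bob alternately color one uncolored vertex of $G$ with one of the $n$ colors, Alice moving first, in such a way that at no point a monochromatic $(k+1)$-clique exists. Alice wins if the game ends with all vertices colored; Bob wins if it ends otherwise, that is, if the player to move has no legal move although some vertex is uncolored. The $k$-clique-relaxed game chromatic number $\chi_{\mathrm g}^{(k)}(G)$ is the least number $n$ of colors for which Alice has a winning strategy. -/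

import Mathlib

namespace CliqueRelaxedGame

/-- A graph is chordal if it has no induced cycle of length at least `4`. -/
def IsChordal {V : Type*} (G : SimpleGraph V) : Prop :=
  ∀ m : ℕ, 4 ≤ m → ¬ (SimpleGraph.cycleGraph m).IsIndContained G

/-- A move: the player gives the colour `m.2` to the vertex `m.1`. -/
abbrev Move (V : Type*) (n : ℕ) := V × Fin n

/-- The record of the game so far, most recent move first. After the record `h`, the vertex `v` has
the colour `α` exactly when `(v, α) ∈ h`. -/
abbrev Record (V : Type*) (n : ℕ) := List (Move V n)

/-- The vertex `v` is coloured after the record `h`. -/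
def IsColored {V : Type*} {n : ℕ} (h : Record V n) (v : V) : Prop :=
  ∃ α : Fin n, (v, α) ∈ h

/-- After the record `h`, some clique on `k + 1` vertices is monochromatic. -/
def HasMonochromaticClique {V : Type*} (G : SimpleGraph V) (k : ℕ) {n : ℕ} (h : Record V n) :
    Prop :=
  ∃ (α : Fin n) (s : Finset V), G.IsNClique (k + 1) s ∧ ∀ v ∈ s, (v, α) ∈ h

/-- The move `m` is legal after the record `h`: its vertex is uncoloured, and colouring it creates
no monochromatic clique on `k + 1` vertices. -/
def IsLegal {V : Type*} (G : SimpleGraph V) (k : ℕ) {n : ℕ} (h : Record V n) (m : Move V n) :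
    Prop :=
  ¬ IsColored h m.1 ∧ ¬ HasMonochromaticClique G k (m :: h)

/-- A strategy for Alice: the move she makes after each record (`none` if she makes no move). -/
abbrev Strategy (V : Type*) (n : ℕ) := Record V n → Option (Move V n)

/-- The records that can arise when all moves are legal, Alice moves first, the players alternate,
and Alice follows the strategy `σ`, while Bob is unrestricted. -/
inductive IsPlay {V : Type*} (G : SimpleGraph V) (k : ℕ) {n : ℕ} (σ : Strategy V n) :
    Record V n → Prop
  | start : IsPlay G k σ []
  | alice {h : Record V n} {m : Move V n} : IsPlay G k σ h → Even h.length → σ h = some m →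
      IsLegal G k h m → IsPlay G k σ (m :: h)
  | bob {h : Record V n} {m : Move V n} : IsPlay G k σ h → Odd h.length →
      IsLegal G k h m → IsPlay G k σ (m :: h)

/-- The strategy `σ` wins for Alice: every play according to `σ` that cannot be continued has
coloured all vertices. (A strategy that fails to supply a legal move while some vertex is
uncoloured loses.) -/
def IsWinning {V : Type*} (G : SimpleGraph V) (k : ℕ) {n : ℕ} (σ : Strategy V n) : Prop :=
  ∀ h : Record V n, IsPlay G k σ h → (∀ m : Move V n, ¬ IsPlay G k σ (m :: h)) →
    ∀ v : V, IsColored h v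

/-- Alice has a winning strategy in the `k`-clique-relaxed colouring game on `G` with `n` colours. -/
def AliceWins {V : Type*} (G : SimpleGraph V) (k n : ℕ) : Prop :=
  ∃ σ : Strategy V n, IsWinning G k σ

/-- The `k`-clique-relaxed game chromatic number of `G`: the least number of colours for which
Alice has a winning strategy (`⊤` if there is none). -/
noncomputable def gameChromaticNumber {V : Type*} (G : SimpleGraph V) (k : ℕ) : ℕ∞ :=
  ⨅ n ∈ {n : ℕ | AliceWins G k n}, (n : ℕ∞)

end CliqueRelaxedGame

/-! ### Perfect elimination rankings of chordal graphs. -/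

namespace CliqueRelaxedGame

/-! Alice plays an activation strategy. In a perfect elimination ranking a vertex and its lower
neighbours form a clique, so clique number 3 leaves each vertex at most two parents `lo` and `hi`,
adjacent to each other. A vertex passes on to `lo` if that is uncoloured, otherwise to `hi` if that
is uncoloured; the receiver is hit. From the vertex Bob has coloured, Alice follows the passes
downwards, activates each inactive vertex she reaches, and colours the first one that was already
active or has no uncoloured parent. If Bob's vertex passes to nobody, she starts at any uncoloured
vertex. A hit activates or colours its receiver, and a hit active vertex is coloured, so no vertex
collects more than two hits.

A colour that appears neither on the parents nor on the hits of `v` is safe at `v`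
(`Ledger.not_threat`). So trouble needs two parents `p`, `q` and two hits carrying all four colours.
If then every colour were threatened, four distinct vertices with higher parent `v` would have hit
`p` or `q`, filling both (`Ledger.exists_not_threat`). The ledger clause `unsaturated` rules this
out. Bob cannot break it, because before his move an uncoloured vertex has at most one hit and
because his vertex passes on; Alice preserves it by her choice of colour
(`Ledger.exists_good_color`). -/

theorem cycleGraph_adj_of_lt {n : ℕ} {i j : Fin (n + 2)} (hij : i.val < j.val) :
    (SimpleGraph.cycleGraph (n + 2)).Adj i j ↔
      j.val = i.val + 1 ∨ (i.val = 0 ∧ j.val = n + 1) := by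
  rw [SimpleGraph.cycleGraph_adj']
  obtain ⟨i, hi⟩ := i
  obtain ⟨j, hj⟩ := j
  simp only [Fin.sub_def] at *
  have h1 : (n + 2 - i + j) % (n + 2) = j - i := by
    rw [show n + 2 - i + j = (j - i) + (n + 2) by omega, Nat.add_mod_right,
      Nat.mod_eq_of_lt (by omega)]
  have h2 : (n + 2 - j + i) % (n + 2) = n + 2 - j + i := Nat.mod_eq_of_lt (by omega)
  rw [h1, h2]
  omega

/-- In a chordal graph, no vertex is adjacent to the two ends of an induced path of length at least
two and to none of its inner vertices. -/
theorem IsChordal.no_cone_over_induced_path {V : Type*} {G : SimpleGraph V} (hG : IsChordal G)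
    {k : ℕ} (hk : 2 ≤ k) {u : ℕ → V} {v : V}
    (hadj : ∀ i < k, G.Adj (u i) (u (i + 1)))
    (hinj : ∀ i j, i < j → j ≤ k → u i ≠ u j)
    (hchord : ∀ i j, i + 1 < j → j ≤ k → ¬ G.Adj (u i) (u j))
    (h0 : G.Adj v (u 0)) (h1 : G.Adj v (u k))
    (hv : ∀ i, 0 < i → i < k → u i ≠ v ∧ ¬ G.Adj v (u i)) : False := by
  apply hG (k + 2) (by omega)
  -- The path and `v`, placed last, form an induced cycle on `k + 2 ≥ 4` vertices.
  let f : Fin (k + 2) → V := fun i => if i.val ≤ k then u i.val else v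
  have hne : ∀ i ≤ k, u i ≠ v := by
    intro i hi
    rcases Nat.eq_zero_or_pos i with rfl | hpos
    · exact h0.ne'
    · rcases hi.lt_or_eq with h | rfl
      · exact (hv i hpos h).1
      · exact h1.ne'
  have hlt : ∀ i j : Fin (k + 2), i.val < j.val →
      f i ≠ f j ∧ (G.Adj (f i) (f j) ↔ (SimpleGraph.cycleGraph (k + 2)).Adj i j) := by
    intro i j hij
    rw [cycleGraph_adj_of_lt hij]
    have hjlt := j.isLt
    have hi : i.val ≤ k := by omega
    by_cases hj : j.val ≤ k
    · simp only [f, if_pos hi, if_pos hj]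
      refine ⟨hinj _ _ hij hj, fun h => ?_, fun h => ?_⟩
      · by_contra hcon
        exact hchord i.val j.val (by omega) hj h
      · rcases h with h | h
        · rw [h]
          exact hadj _ (by omega)
        · omega
    · simp only [f, if_pos hi, if_neg hj]
      refine ⟨hne _ hi, fun h => ?_, fun h => ?_⟩
      · by_contra hcon
        exact (hv i.val (by omega) (by omega)).2 h.symm
      · rcases h with h | h
        · rw [show i.val = k by omega]
          exact h1.symm
        · rw [h.1]
          exact h0.symm
  refine ⟨⟨⟨f, fun i j hij => ?_⟩, fun {i j} => ?_⟩⟩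
  · rcases lt_trichotomy i.val j.val with h | h | h
    · exact absurd hij (hlt i j h).1
    · exact Fin.ext h
    · exact absurd hij.symm (hlt j i h).1
  · change G.Adj (f i) (f j) ↔ _
    rcases lt_trichotomy i.val j.val with h | h | h
    · exact (hlt i j h).2
    · rw [Fin.ext h]
      simp
    · exact (G.adj_comm _ _).trans ((hlt j i h).2.trans (SimpleGraph.adj_comm _ _ _))

/-- In a chordal graph, two neighbours of `v` are adjacent if they are joined by a path whose inner
vertices are not adjacent to `v`. -/
theorem IsChordal.adj_of_path {V : Type*} {G : SimpleGraph V} (hG : IsChordal G)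
    {x y v : V} (hxy : x ≠ y) (hvx : G.Adj v x) (hvy : G.Adj v y)
    (hpath : ∃ (k : ℕ) (u : ℕ → V), u 0 = x ∧ u k = y ∧ (∀ i < k, G.Adj (u i) (u (i + 1))) ∧
      ∀ i, 0 < i → i < k → u i ≠ v ∧ ¬ G.Adj v (u i)) : G.Adj x y := by
  classical
  by_contra hnadj
  obtain ⟨u, h0, hk, hadj, hv⟩ := Nat.find_spec hpath
  have hmin := fun m => Nat.find_min hpath (m := m)
  generalize Nat.find hpath = k at *
  have hk2 : 2 ≤ k := by
    by_contra hlt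
    have : k = 0 ∨ k = 1 := by omega
    rcases this with rfl | rfl
    · exact hxy (h0.symm.trans hk)
    · have := hadj 0 one_pos
      rw [h0, hk] at this
      exact hnadj this
  -- A shortest path is induced: a repetition `u i = u j` would save `j - i` steps, a chord `j - i -
  -- 1`.
  refine hG.no_cone_over_induced_path hk2 hadj ?_ ?_ (h0 ▸ hvx) (hk ▸ hvy) hv
  · intro i j hij hjk heq
    refine hmin (k - (j - i)) (by omega)
      ⟨fun n => if n ≤ i then u n else u (n + (j - i)), by simpa using h0, ?_, ?_, ?_⟩
    · dsimp only
      split_ifs with h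
      · have : j = k := by omega
        rw [show k - (j - i) = i by omega, heq, this, hk]
      · rw [show k - (j - i) + (j - i) = k by omega, hk]
    · intro n hn
      dsimp only
      split_ifs with h h' h'
      · exact hadj n (by omega)
      · have : n = i := by omega
        subst this
        rw [heq, show n + 1 + (j - n) = j + 1 by omega]
        exact hadj j (by omega)
      · omega
      · rw [show n + 1 + (j - i) = n + (j - i) + 1 by omega]
        exact hadj _ (by omega)
    · intro n hn hnk
      dsimp only
      split_ifs with h
      · exact hv n hn (by omega)
      · exact hv _ (by omega) (by omega)
  · intro i j hij hjk hch
    refine hmin (k - (j - i - 1)) (by omega)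
      ⟨fun n => if n ≤ i then u n else u (n + (j - i - 1)), by simpa using h0, ?_, ?_, ?_⟩
    · dsimp only
      rw [if_neg (by omega), show k - (j - i - 1) + (j - i - 1) = k by omega, hk]
    · intro n hn
      dsimp only
      split_ifs with h h' h'
      · exact hadj n (by omega)
      · have : n = i := by omega
        subst this
        rw [show n + 1 + (j - n - 1) = j by omega]
        exact hch
      · omega
      · rw [show n + 1 + (j - i - 1) = n + (j - i - 1) + 1 by omega]
        exact hadj _ (by omega)
    · intro n hn hnk
      dsimp only
      split_ifs with h
      · exact hv n hn (by omega)
      · exact hv _ (by omega) (by omega)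

/-- Turns a chain inside `D` into the indexed path that `IsChordal.adj_of_path` needs; the start `x`
may lie outside `D`. -/
theorem exists_path_of_reflTransGen {V : Type*} {G : SimpleGraph V} {D : V → Prop} {x a b : V}
    (hxa : G.Adj x a) (ha : D a)
    (hab : Relation.ReflTransGen (fun p q => D q ∧ G.Adj p q) a b) :
    ∃ (k : ℕ) (u : ℕ → V), u 0 = x ∧ u (k + 1) = b ∧ (∀ i < k + 1, G.Adj (u i) (u (i + 1))) ∧
      ∀ i, 0 < i → i ≤ k + 1 → D (u i) := by
  induction hab with
  | refl =>
    refine ⟨0, fun n => if n = 0 then x else a, by simp, by simp, ?_, ?_⟩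
    · intro i hi
      have : i = 0 := by omega
      subst this
      simpa using hxa
    · intro i hi _
      simpa [hi.ne'] using ha
  | @tail b d _ hbd ih =>
    obtain ⟨k, u, h0, hk, hadj, hD⟩ := ih
    refine ⟨k + 1, fun n => if n ≤ k + 1 then u n else d, by simpa using h0, by simp, ?_, ?_⟩
    · intro i hi
      dsimp only
      rw [if_pos (by omega : i ≤ k + 1)]
      split_ifs with h
      · exact hadj i (by omega)
      · rw [show i = k + 1 by omega, hk]
        exact hbd.2
    · intro i hi hik
      dsimp only
      split_ifs with h
      · exact hD i hi h
      · exact hbd.1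

/-- Dirac's theorem: in a set of vertices of a chordal graph, every vertex that is not adjacent to
all others has a simplicial non-neighbour. -/
theorem IsChordal.exists_simplicial_not_adj {V : Type*} {G : SimpleGraph V} (hG : IsChordal G)
    (W : Finset V) : ∀ v ∈ W, (∃ w ∈ W, w ≠ v ∧ ¬ G.Adj v w) →
      ∃ s ∈ W, s ≠ v ∧ ¬ G.Adj v s ∧
        ∀ a ∈ W, ∀ b ∈ W, G.Adj s a → G.Adj s b → a ≠ b → G.Adj a b := by
  classical
  induction W using Finset.strongInduction with
  | H W ih =>
  rintro v hvW ⟨c₀, hc₀W, hc₀v, hvc₀⟩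
  -- `D` is the set of non-neighbours of `v`, `C` the component of `c₀` in it, and `S` the
  -- neighbours of `v` that touch `C`. Two vertices of `S` are joined by a path through `C`, so `S`
  -- is a clique.
  let D : V → Prop := fun a => a ∈ W ∧ a ≠ v ∧ ¬ G.Adj v a
  let R : V → V → Prop := fun p q => D q ∧ G.Adj p q
  have hDc₀ : D c₀ := ⟨hc₀W, hc₀v, hvc₀⟩
  have hRD : ∀ c, Relation.ReflTransGen R c₀ c → D c := by
    intro c hc
    cases hc with
    | refl => exact hDc₀
    | tail _ h => exact h.1
  have hRsymm : ∀ c, Relation.ReflTransGen R c₀ c → Relation.ReflTransGen R c c₀ := by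
    intro c hc
    induction hc with
    | refl => exact .refl
    | @tail b d hb hbd ih' => exact .head ⟨hRD b hb, hbd.2.symm⟩ ih'
  let C : Finset V := W.filter fun c => Relation.ReflTransGen R c₀ c
  let S : Finset V := W.filter fun s => G.Adj v s ∧ ∃ c ∈ C, G.Adj s c
  have hC : ∀ c, c ∈ C ↔ Relation.ReflTransGen R c₀ c := by
    intro c
    simp only [C, Finset.mem_filter, and_iff_right_iff_imp]
    exact fun h => (hRD c h).1
  have hnbr : ∀ c ∈ C, ∀ a ∈ W, G.Adj c a → a ∈ C ∪ S := by
    intro c hc a ha hca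
    have hcD := hRD c ((hC c).1 hc)
    rw [Finset.mem_union]
    by_cases hva : G.Adj v a
    · exact Or.inr (Finset.mem_filter.2 ⟨ha, hva, c, hc, hca.symm⟩)
    · refine Or.inl ((hC a).2 (((hC c).1 hc).tail ⟨⟨ha, ?_, hva⟩, hca⟩))
      rintro rfl
      exact hcD.2.2 hca.symm
  have hS : ∀ x ∈ S, ∀ y ∈ S, x ≠ y → G.Adj x y := by
    intro x hx y hy hxy
    obtain ⟨-, hvx, a, ha, hxa⟩ := Finset.mem_filter.1 hx
    obtain ⟨-, hvy, b, hb, hyb⟩ := Finset.mem_filter.1 hy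
    have haC := (hC a).1 ha
    have hbC := (hC b).1 hb
    obtain ⟨k, u, h0, hk, hadj, hD⟩ :=
      exists_path_of_reflTransGen hxa (hRD a haC) ((hRsymm a haC).trans hbC)
    refine hG.adj_of_path hxy hvx hvy
      ⟨k + 2, fun n => if n ≤ k + 1 then u n else y, by simpa using h0, by simp, ?_, ?_⟩
    · intro i hi
      dsimp only
      rw [if_pos (by omega : i ≤ k + 1)]
      split_ifs with h
      · exact hadj i (by omega)
      · rw [show i = k + 1 by omega, hk]
        exact hyb.symm
    · intro i hi hik
      dsimp only
      rw [if_pos (by omega : i ≤ k + 1)]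
      exact (hD i hi (by omega)).2
  have hsub : C ∪ S ⊂ W := by
    refine (Finset.ssubset_iff_of_subset ?_).2 ⟨v, hvW, ?_⟩
    · exact Finset.union_subset (Finset.filter_subset _ _) (Finset.filter_subset _ _)
    · rw [Finset.mem_union]
      rintro (h | h)
      · exact (hRD v ((hC v).1 h)).2.1 rfl
      · exact (Finset.mem_filter.1 h).2.1.ne rfl
  -- All neighbours in `W` of a vertex of `C` lie in `C ∪ S`, so being simplicial there is enough.
  suffices h : ∃ s ∈ C, ∀ a ∈ C ∪ S, ∀ b ∈ C ∪ S, G.Adj s a → G.Adj s b → a ≠ b → G.Adj a b by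
    obtain ⟨s, hs, hsimp⟩ := h
    have hsD := hRD s ((hC s).1 hs)
    exact ⟨s, hsD.1, hsD.2.1, hsD.2.2, fun a ha b hb hsa hsb =>
      hsimp a (hnbr s hs a ha hsa) b (hnbr s hs b hb hsb) hsa hsb⟩
  -- The induction hypothesis must yield a vertex of `C`, not of `S`. From `p ∈ S` this holds
  -- because `S` is a clique; from `p ∈ C`, because by then each vertex of `S` is adjacent to all
  -- others. If neither kind of `p` exists, `C ∪ S` is a clique.
  by_cases h1 : ∃ p ∈ S, ∃ w ∈ C ∪ S, w ≠ p ∧ ¬ G.Adj p w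
  · obtain ⟨p, hp, hw⟩ := h1
    obtain ⟨s, hs, hsp, hps, hsimp⟩ := ih _ hsub p (Finset.mem_union_right _ hp) hw
    rcases Finset.mem_union.1 hs with hs | hs
    · exact ⟨s, hs, hsimp⟩
    · exact absurd (hS p hp s hs hsp.symm) hps
  · push Not at h1
    by_cases h2 : ∃ p ∈ C, ∃ w ∈ C ∪ S, w ≠ p ∧ ¬ G.Adj p w
    · obtain ⟨p, hp, hw⟩ := h2
      have hpW := Finset.mem_union_left S hp
      obtain ⟨s, hs, hsp, hps, hsimp⟩ := ih _ hsub p hpW hw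
      rcases Finset.mem_union.1 hs with hs | hs
      · exact ⟨s, hs, hsimp⟩
      · exact absurd (h1 s hs p hpW hsp.symm).symm hps
    · push Not at h2
      refine ⟨c₀, (hC c₀).2 .refl, fun a ha b hb _ _ hab => ?_⟩
      rcases Finset.mem_union.1 ha with ha | ha
      · exact h2 a ha b hb hab.symm
      · exact h1 a ha b hb hab.symm

/-- A finite set of vertices of a chordal graph has a perfect elimination ranking. -/
theorem IsChordal.exists_elimination_ranking {V : Type*} {G : SimpleGraph V} (hG : IsChordal G)
    (W : Finset V) : ∃ r : V → ℕ, Set.InjOn r W ∧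
      ∀ x ∈ W, ∀ a ∈ W, ∀ b ∈ W, r a < r x → r b < r x → G.Adj a x → G.Adj b x → a ≠ b →
        G.Adj a b := by
  classical
  induction W using Finset.strongInduction with
  | H W ih =>
  rcases W.eq_empty_or_nonempty with rfl | ⟨v, hv⟩
  · exact ⟨fun _ => 0, by simp, by simp⟩
  obtain ⟨s, hs, hsimp⟩ : ∃ s ∈ W,
      ∀ a ∈ W, ∀ b ∈ W, G.Adj s a → G.Adj s b → a ≠ b → G.Adj a b := by
    by_cases h : ∃ p ∈ W, ∃ w ∈ W, w ≠ p ∧ ¬ G.Adj p w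
    · obtain ⟨p, hp, hw⟩ := h
      obtain ⟨s, hs, -, -, hsimp⟩ := hG.exists_simplicial_not_adj W p hp hw
      exact ⟨s, hs, hsimp⟩
    · push Not at h
      exact ⟨v, hv, fun a ha b hb _ _ hab => h a ha b hb hab.symm⟩
  obtain ⟨r, hinj, hr⟩ := ih (W.erase s) (Finset.erase_ssubset hs)
  -- The new rank exceeds all others, so the simplicial vertex `s` comes last.
  have hbound : ∀ a ∈ W.erase s, r a < (W.erase s).sup r + 1 := fun a ha =>
    Nat.lt_succ_of_le (Finset.le_sup ha)
  generalize (W.erase s).sup r + 1 = N at hbound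
  have hupd : ∀ a, a ≠ s → Function.update r s N a = r a := fun a ha =>
    Function.update_of_ne ha _ _
  have hlt : ∀ a ∈ W, a ≠ s → Function.update r s N a < N := fun a ha has => by
    rw [hupd a has]
    exact hbound a (Finset.mem_erase.2 ⟨has, ha⟩)
  refine ⟨Function.update r s N, ?_, ?_⟩
  · intro a ha b hb hab
    by_cases has : a = s <;> by_cases hbs : b = s
    · rw [has, hbs]
    · have := hlt b hb hbs
      rw [← hab, has, Function.update_self] at this
      exact absurd this (lt_irrefl _)
    · have := hlt a ha has
      rw [hab, hbs, Function.update_self] at this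
      exact absurd this (lt_irrefl _)
    · rw [hupd a has, hupd b hbs] at hab
      exact hinj (Finset.mem_coe.2 (Finset.mem_erase.2 ⟨has, ha⟩))
        (Finset.mem_coe.2 (Finset.mem_erase.2 ⟨hbs, hb⟩)) hab
  · intro x hx a ha b hb hax hbx hadj hbdj hab
    by_cases hxs : x = s
    · subst hxs
      exact hsimp a ha b hb hadj.symm hbdj.symm hab
    · have hxN := hlt x hx hxs
      have hns : ∀ a, Function.update r s N a < Function.update r s N x → a ≠ s := by
        rintro a h rfl
        rw [Function.update_self] at h
        omega
      have has := hns a hax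
      have hbs := hns b hbx
      rw [hupd a has, hupd x hxs] at hax
      rw [hupd b hbs, hupd x hxs] at hbx
      exact hr x (Finset.mem_erase.2 ⟨hxs, hx⟩) a (Finset.mem_erase.2 ⟨has, ha⟩) b
        (Finset.mem_erase.2 ⟨hbs, hb⟩) hax hbx hadj hbdj hab

/-! ### Parents, passing on, and the shapes of a threat. -/

/-- A ranking of the vertices in which every vertex has at most two neighbours of smaller rank: the
higher one `hi` (or the only one), and the lower one `lo` in case there are two. These two are
adjacent. -/
structure ParentSystem {V : Type*} (G : SimpleGraph V) where
  rank : V → ℕ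
  rank_injective : Function.Injective rank
  lo : V → Option V
  hi : V → Option V
  adj_iff : ∀ p x, rank p < rank x → (G.Adj p x ↔ lo x = some p ∨ hi x = some p)
  hi_lt : ∀ p x, hi x = some p → rank p < rank x
  exists_hi : ∀ p x, lo x = some p → ∃ q, hi x = some q ∧ rank p < rank q ∧ G.Adj p q

/-- Three lower neighbours would form a 4-clique with their vertex. A single lower neighbour is
stored as `hi`, with `lo` empty. -/
theorem IsChordal.nonempty_parentSystem {V : Type*} [Finite V] {G : SimpleGraph V}
    (hG : IsChordal G) (hclique : G.cliqueNum ≤ 3) : Nonempty (ParentSystem G) := by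
  classical
  have := Fintype.ofFinite V
  obtain ⟨r, hinj, hr⟩ := hG.exists_elimination_ranking Finset.univ
  replace hinj : Function.Injective r := fun a b h => hinj (by simp) (by simp) h
  replace hr : ∀ x a b, r a < r x → r b < r x → G.Adj a x → G.Adj b x → a ≠ b → G.Adj a b :=
    fun x a b => hr x (Finset.mem_univ _) a (Finset.mem_univ _) b (Finset.mem_univ _)
  have key : ∀ x, ∃ l h : Option V,
      (∀ p, r p < r x → (G.Adj p x ↔ l = some p ∨ h = some p)) ∧
      (∀ p, h = some p → r p < r x) ∧
      ∀ p, l = some p → ∃ q, h = some q ∧ r p < r q ∧ G.Adj p q := by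
    intro x
    let P : Finset V := Finset.univ.filter fun p => r p < r x ∧ G.Adj p x
    have hP : ∀ p, p ∈ P ↔ r p < r x ∧ G.Adj p x := by simp [P]
    rcases P.eq_empty_or_nonempty with hempty | hne
    · refine ⟨none, none, fun p hp => ?_, by simp, by simp⟩
      have : p ∉ P := by simp [hempty]
      rw [hP] at this
      simpa [hp] using this
    obtain ⟨q, hq, hmax⟩ := P.exists_max_image r hne
    have hq' := (hP q).1 hq
    by_cases hone : ∀ p ∈ P, p = q
    · refine ⟨none, some q, fun p hp => ?_, by rintro p ⟨⟩; exact hq'.1, by simp⟩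
      constructor
      · intro h
        rw [hone p ((hP p).2 ⟨hp, h⟩)]
        exact Or.inr rfl
      · rintro (h | h)
        · cases h
        · cases h
          exact hq'.2
    push Not at hone
    obtain ⟨p, hp, hpq⟩ := hone
    have hp' := (hP p).1 hp
    have hadj := hr x p q hp'.1 hq'.1 hp'.2 hq'.2 hpq
    refine ⟨some p, some q, fun s hs => ?_, by rintro p ⟨⟩; exact hq'.1, ?_⟩
    · constructor
      · intro h
        by_contra hcon
        simp only [Option.some.injEq, not_or] at hcon
        have hcl : G.IsClique (({s, p, q, x} : Finset V) : Set V) := by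
          have h1 := hr x s p hs hp'.1 h hp'.2 (Ne.symm hcon.1)
          have h2 := hr x s q hs hq'.1 h hq'.2 (Ne.symm hcon.2)
          simp [SimpleGraph.isClique_insert, h1, h2, h, hadj, hp'.2, hq'.2]
        have hcard := hcl.card_le_cliqueNum
        rw [Finset.card_insert_of_notMem, Finset.card_insert_of_notMem,
          Finset.card_insert_of_notMem, Finset.card_singleton] at hcard
        · omega
        · simpa using hq'.2.ne
        · simpa using ⟨hpq, hp'.2.ne⟩
        · simpa using ⟨Ne.symm hcon.1, Ne.symm hcon.2, h.ne⟩
      · rintro (h | h) <;> cases h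
        · exact hp'.2
        · exact hq'.2
    · rintro _ ⟨⟩
      exact ⟨q, rfl, (hmax p hp).lt_of_ne (fun h => hpq (hinj h)), hadj⟩
  choose l h h1 h2 h3 using key
  exact ⟨⟨r, hinj, l, h, fun p x => h1 x p, fun p x => h2 x p, fun p x => h3 x p⟩⟩

namespace ParentSystem

variable {V : Type*} {G : SimpleGraph V} (P : ParentSystem G)

theorem lo_lt {p x : V} (h : P.lo x = some p) : P.rank p < P.rank x := by
  obtain ⟨q, hq, hpq, -⟩ := P.exists_hi p x h
  exact hpq.trans (P.hi_lt q x hq)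

theorem lo_lt_hi {p q x : V} (hp : P.lo x = some p) (hq : P.hi x = some q) :
    P.rank p < P.rank q := by
  obtain ⟨q', hq', hpq, -⟩ := P.exists_hi p x hp
  rw [hq, Option.some.injEq] at hq'
  rwa [hq']

theorem adj_lo_hi {p q x : V} (hp : P.lo x = some p) (hq : P.hi x = some q) : G.Adj p q := by
  obtain ⟨q', hq', -, hadj⟩ := P.exists_hi p x hp
  rw [hq, Option.some.injEq] at hq'
  rwa [hq']

theorem lo_eq_and_hi_eq {p q x : V} (hpq : P.rank p < P.rank q) (hqx : P.rank q < P.rank x)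
    (hp : G.Adj p x) (hq : G.Adj q x) : P.lo x = some p ∧ P.hi x = some q := by
  rcases (P.adj_iff p x (hpq.trans hqx)).1 hp with hp | hp <;>
    rcases (P.adj_iff q x hqx).1 hq with hq | hq
  · rw [hp, Option.some.injEq] at hq
    exact absurd hpq (hq ▸ lt_irrefl _)
  · exact ⟨hp, hq⟩
  · exact absurd (P.lo_lt_hi hq hp) hpq.not_gt
  · rw [hp, Option.some.injEq] at hq
    exact absurd hpq (hq ▸ lt_irrefl _)

/-- `x` passes on to `y`: its lower parent if that is uncoloured, else its higher parent if that is
uncoloured. -/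
def Next (c : V → Option (Fin 4)) (x y : V) : Prop :=
  c y = none ∧ (P.lo x = some y ∨ (P.hi x = some y ∧ ∀ p, P.lo x = some p → c p ≠ none))

theorem Next.lt {P : ParentSystem G} {c : V → Option (Fin 4)} {x y : V} (h : P.Next c x y) :
    P.rank y < P.rank x := by
  rcases h.2 with h | h
  · exact P.lo_lt h
  · exact P.hi_lt _ _ h.1

theorem parents_colored_of_not_next {c : V → Option (Fin 4)} {x : V} (h : ∀ y, ¬ P.Next c x y)
    {p : V} (hp : P.lo x = some p ∨ P.hi x = some p) : c p ≠ none := by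
  have hlo : ∀ p, P.lo x = some p → c p ≠ none := fun p hp hc => h p ⟨hc, Or.inl hp⟩
  rcases hp with hp | hp
  · exact hlo p hp
  · exact fun hc => h p ⟨hc, Or.inr ⟨hp, hlo⟩⟩

/-- Giving the colour `γ` to `v` would complete a monochromatic triangle. -/
def Threat (G : SimpleGraph V) (c : V → Option (Fin 4)) (v : V) (γ : Fin 4) : Prop :=
  ∃ a b, G.Adj a b ∧ G.Adj a v ∧ G.Adj b v ∧ c a = some γ ∧ c b = some γ

/-- With `a` ranked below `b`, the cases are `v` at the top, in the middle or at the bottom of the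
triangle; its top vertex always has the other two as parents. -/
theorem Threat.cases {c : V → Option (Fin 4)} {v : V} {γ : Fin 4} (h : Threat G c v γ) :
    ∃ a b, c a = some γ ∧ c b = some γ ∧
      ((P.lo v = some a ∧ P.hi v = some b) ∨
        ((P.lo v = some a ∨ P.hi v = some a) ∧ P.lo b = some a ∧ P.hi b = some v) ∨
        (P.lo b = some v ∧ P.hi b = some a)) := by
  obtain ⟨a, b, hab, hav, hbv, ha, hb⟩ := h
  wlog hlt : P.rank a < P.rank b generalizing a b
  · exact this b a hab.symm hbv hav hb ha
      ((not_lt.1 hlt).lt_of_ne fun h => hab.ne (P.rank_injective h).symm)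
  refine ⟨a, b, ha, hb, ?_⟩
  rcases lt_or_gt_of_ne (fun h => hav.ne (P.rank_injective h) : P.rank a ≠ P.rank v) with h1 | h1
  · rcases lt_or_gt_of_ne (fun h => hbv.ne (P.rank_injective h) : P.rank b ≠ P.rank v) with h2 | h2
    · exact Or.inl (P.lo_eq_and_hi_eq hlt h2 hav hbv)
    · exact Or.inr (Or.inl ⟨(P.adj_iff _ _ h1).1 hav, P.lo_eq_and_hi_eq h1 h2 hab hbv.symm⟩)
  · exact Or.inr (Or.inr (P.lo_eq_and_hi_eq h1 hlt hbv.symm hab))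

variable [DecidableEq V]

/-- The neighbours of smaller rank. -/
def parents (v : V) : Finset V := (P.lo v).toFinset ∪ (P.hi v).toFinset

theorem mem_parents {p v : V} : p ∈ P.parents v ↔ P.lo v = some p ∨ P.hi v = some p := by
  simp [parents, Option.mem_toFinset]

theorem card_parents_le (v : V) : (P.parents v).card ≤ 2 := by
  refine (Finset.card_union_le _ _).trans ?_
  have : ∀ o : Option V, o.toFinset.card ≤ 1 := by
    intro o
    cases o <;> simp
  have h1 := this (P.lo v)
  have h2 := this (P.hi v)
  omega

end ParentSystem

/-! ### Counting colours on parents and hits. -/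

/-- The colours that occur in `S`. -/
def colorsIn {V : Type*} (c : V → Option (Fin 4)) (S : Finset V) : Finset (Fin 4) :=
  Finset.univ.filter fun γ => ∃ x ∈ S, c x = some γ

theorem mem_colorsIn {V : Type*} {c : V → Option (Fin 4)} {S : Finset V} {γ : Fin 4} :
    γ ∈ colorsIn c S ↔ ∃ x ∈ S, c x = some γ := by
  simp [colorsIn]

theorem card_colorsIn_le {V : Type*} (c : V → Option (Fin 4)) (S : Finset V) :
    (colorsIn c S).card ≤ S.card := by
  classical
  refine (Finset.card_le_card ?_).trans (Finset.card_image_le (s := S) (f := fun x => (c x).getD 0))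
  intro γ hγ
  obtain ⟨x, hx, hc⟩ := mem_colorsIn.1 hγ
  exact Finset.mem_image.2 ⟨x, hx, by simp [hc]⟩

theorem eq_or_eq_of_card_le_two {α : Type*} {S : Finset α} (hS : S.card ≤ 2) {x y w : α}
    (hx : x ∈ S) (hy : y ∈ S) (hw : w ∈ S) (hxy : x ≠ y) : w = x ∨ w = y := by
  by_contra hcon
  rw [not_or] at hcon
  have := Finset.two_lt_card.2 ⟨x, hx, y, hy, w, hw, hxy, Ne.symm hcon.1, Ne.symm hcon.2⟩
  omega

namespace ParentSystem

variable {V : Type*} {G : SimpleGraph V} (P : ParentSystem G) [DecidableEq V]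

/-- If all four colours occur on the parents of `v` and a set of at most two further vertices, then
they occur once each. -/
theorem exists_of_colorsIn_union_eq_univ {c : V → Option (Fin 4)} {v : V} {S : Finset V}
    (hS : S.card ≤ 2) (h : colorsIn c (P.parents v) ∪ colorsIn c S = Finset.univ) :
    ∃ p q x y : V, ∃ α β γ δ : Fin 4, P.lo v = some p ∧ P.hi v = some q ∧
      (∀ w ∈ S, w = x ∨ w = y) ∧ x ≠ y ∧ [α, β, γ, δ].Nodup ∧
      c p = some α ∧ c q = some β ∧ c x = some γ ∧ c y = some δ := by
  have h1 := (card_colorsIn_le c (P.parents v)).trans (P.card_parents_le v)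
  have h2 := (card_colorsIn_le c S).trans hS
  have h3 := Finset.card_union_add_card_inter (colorsIn c (P.parents v)) (colorsIn c S)
  rw [h, Finset.card_univ, Fintype.card_fin] at h3
  -- Two sets of at most two colours cover all four only if they are disjoint and both have size
  -- two.
  have h4 : colorsIn c (P.parents v) ∩ colorsIn c S = ∅ := Finset.card_eq_zero.1 (by omega)
  obtain ⟨α, β, hαβ, hp⟩ := Finset.card_eq_two.1
    (by omega : (colorsIn c (P.parents v)).card = 2)
  obtain ⟨γ, δ, hγδ, hs⟩ := Finset.card_eq_two.1 (by omega : (colorsIn c S).card = 2)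
  obtain ⟨x, hx, hcx⟩ := mem_colorsIn.1 (by simp [hs] : γ ∈ colorsIn c S)
  obtain ⟨y, hy, hcy⟩ := mem_colorsIn.1 (by simp [hs] : δ ∈ colorsIn c S)
  obtain ⟨p, hpv, hcp⟩ := mem_colorsIn.1 (by simp [hp] : α ∈ colorsIn c (P.parents v))
  obtain ⟨q, hqv, hcq⟩ := mem_colorsIn.1 (by simp [hp] : β ∈ colorsIn c (P.parents v))
  have hxy : x ≠ y := by
    rintro rfl
    exact hγδ (Option.some.inj (hcx.symm.trans hcy))
  have hpq : p ≠ q := by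
    rintro rfl
    exact hαβ (Option.some.inj (hcp.symm.trans hcq))
  have hdisj : ∀ ε ∈ colorsIn c (P.parents v), ε ∉ colorsIn c S := fun ε ha hb => by
    have : ε ∈ colorsIn c (P.parents v) ∩ colorsIn c S := Finset.mem_inter.2 ⟨ha, hb⟩
    simp [h4] at this
  have hα := hdisj α (by simp [hp])
  have hβ := hdisj β (by simp [hp])
  simp only [hs, Finset.mem_insert, Finset.mem_singleton, not_or] at hα hβ
  have hSxy : ∀ w ∈ S, w = x ∨ w = y := fun w hw => eq_or_eq_of_card_le_two hS hx hy hw hxy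
  rw [P.mem_parents] at hpv hqv
  rcases hpv with hpv | hpv <;> rcases hqv with hqv | hqv
  · exact absurd (Option.some.inj (hpv.symm.trans hqv)) hpq
  · exact ⟨p, q, x, y, α, β, γ, δ, hpv, hqv, hSxy, hxy, by simp; tauto, hcp, hcq, hcx, hcy⟩
  · exact ⟨q, p, x, y, β, α, γ, δ, hqv, hpv, hSxy, hxy, by simp; tauto, hcq, hcp, hcx, hcy⟩
  · exact absurd (Option.some.inj (hpv.symm.trans hqv)) hpq

/-! ### The ledger and safe colours. -/

/-- The invariant behind Alice's strategy. The vertices in `A` are active, and `hits v` is the set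
of the vertices that have passed on to `v`. -/
structure Ledger (c : V → Option (Fin 4)) (A : Set V) (hits : V → Finset V) : Prop where
  mem_of_colored : ∀ x γ, c x = some γ → x ∈ A
  card_hits : ∀ v, (hits v).card ≤ 2
  lo_mem : ∀ x ∈ A, ∀ p, P.lo x = some p → c p = none → x ∈ hits p
  -- An active vertex may have spent its pass on its lower parent.
  hi_mem : ∀ x ∈ A, ∀ v, P.hi x = some v → c v = none →
    x ∈ hits v ∨ ∃ p, P.lo x = some p ∧ x ∈ hits p
  -- When `q` and `y` threaten `v` in the colour of `q`, the hits of `p` and `q` must not all be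
  -- used up by vertices with higher parent `v`. The alternative `c p = some γ` is harmless, since
  -- then the parents of `v` carry only one colour.
  unsaturated : ∀ v p q y γ, c v = none → P.lo v = some p → P.hi v = some q →
    P.lo y = some q → P.hi y = some v → y ∉ hits v → c q = some γ → c y = some γ →
    (∀ z ∈ hits q, P.hi z = some v → z = y) ∨ c p = some γ ∨ ∃ w ∈ hits p, P.hi w ≠ some v

namespace Ledger

variable {P} {c : V → Option (Fin 4)} {A : Set V} {hits : V → Finset V}

/-- In the first two shapes of a threat a parent of `v` has the colour. In the third, `v` is the
lower parent of a coloured vertex, which must have hit it. -/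
theorem not_threat (hL : P.Ledger c A hits) {v : V} {γ : Fin 4} (hv : c v = none)
    (h1 : γ ∉ colorsIn c (P.parents v)) (h2 : γ ∉ colorsIn c (hits v)) : ¬ Threat G c v γ := by
  intro hT
  obtain ⟨a, b, ha, hb, h | h | h⟩ := hT.cases P
  · exact h1 (mem_colorsIn.2 ⟨a, P.mem_parents.2 (Or.inl h.1), ha⟩)
  · exact h1 (mem_colorsIn.2 ⟨a, P.mem_parents.2 h.1, ha⟩)
  · exact h2 (mem_colorsIn.2 ⟨b, hL.lo_mem b (hL.mem_of_colored b γ hb) v h.1 hv, hb⟩)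

/-- Every uncoloured vertex has a legal colour. -/
theorem exists_not_threat (hL : P.Ledger c A hits) {v : V} (hv : c v = none) :
    ∃ γ, ¬ Threat G c v γ := by
  by_cases hsat : colorsIn c (P.parents v) ∪ colorsIn c (hits v) = Finset.univ
  swap
  · obtain ⟨γ, hγ⟩ := not_forall.1 fun h => hsat (Finset.eq_univ_iff_forall.2 h)
    rw [Finset.mem_union, not_or] at hγ
    exact ⟨γ, hL.not_threat hv hγ.1 hγ.2⟩
  by_contra! hT
  obtain ⟨p, q, x, y, α, β, γ, δ, hp, hq, hxy, hne, hnodup, hcp, hcq, hcx, hcy⟩ :=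
    P.exists_of_colorsIn_union_eq_univ (hL.card_hits v) hsat
  simp only [List.nodup_cons, List.mem_cons, List.not_mem_nil, or_false, not_or,
    List.nodup_nil, and_true, not_false_eq_true] at hnodup
  obtain ⟨⟨hαβ, hαγ, hαδ⟩, ⟨hβγ, hβδ⟩, hγδ⟩ := hnodup
  have hcol : ∀ {a : V} {ε ε' : Fin 4}, c a = some ε → c a = some ε' → ε = ε' :=
    fun h h' => Option.some.inj (h.symm.trans h')
  have hcolor : ∀ w ∈ hits v, ∀ ε, c w = some ε → ε = γ ∨ ε = δ := by
    intro w hw ε hε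
    rcases hxy w hw with rfl | rfl
    · exact Or.inl (hcol hε hcx)
    · exact Or.inr (hcol hε hcy)
  have hpar : ∀ a, P.lo v = some a ∨ P.hi v = some a → a = p ∨ a = q := by
    rintro a (h | h)
    · exact Or.inl (Option.some.inj (h.symm.trans hp))
    · exact Or.inr (Option.some.inj (h.symm.trans hq))
  have hlo : ∀ w ε, c w = some ε → P.lo w = some v → w ∈ hits v := fun w ε hw h =>
    hL.lo_mem w (hL.mem_of_colored w ε hw) v h hv
  have hhi : ∀ w ε, c w = some ε → P.hi w = some v → w ∉ hits v →
      ∃ a, P.lo w = some a ∧ w ∈ hits a := fun w ε hw h hn =>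
    (hL.hi_mem w (hL.mem_of_colored w ε hw) v h hv).resolve_left hn
  -- A threat in the colour of a parent comes from a vertex below that parent and `v`.
  have key₁ : ∀ a ε, P.lo v = some a ∨ P.hi v = some a → c a = some ε → ε ≠ γ → ε ≠ δ →
      ∃ z, c z = some ε ∧ P.hi z = some v ∧ z ∉ hits v ∧ P.lo z = some a ∧ z ∈ hits a := by
    intro a ε hav hca hεγ hεδ
    have hinj : ∀ b, P.lo v = some b ∨ P.hi v = some b → c b = some ε → b = a := by
      intro b hbv hcb
      rcases hpar a hav with rfl | rfl <;> rcases hpar b hbv with rfl | rfl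
      · rfl
      · exact absurd ((hcol hcp hca).trans (hcol hcb hcq)) hαβ
      · exact absurd ((hcol hcp hcb).trans (hcol hca hcq)) hαβ
      · rfl
    obtain ⟨b, z, hcb, hcz, h | h | h⟩ := (hT ε).cases P
    · have h1 := hinj b (Or.inl h.1) hcb
      have h2 := hinj z (Or.inr h.2) hcz
      exact absurd (P.lo_lt_hi h.1 h.2) (by rw [h1, h2]; exact lt_irrefl _)
    · obtain ⟨hbv, hlz, hhz⟩ := h
      obtain rfl := hinj b hbv hcb
      have hz : z ∉ hits v := fun hz => by
        rcases hcolor z hz ε hcz with h | h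
        · exact hεγ h
        · exact hεδ h
      obtain ⟨b', hb', hzb'⟩ := hhi z ε hcz hhz hz
      obtain rfl := Option.some.inj (hb'.symm.trans hlz)
      exact ⟨z, hcz, hhz, hz, hlz, hzb'⟩
    · rcases hcolor z (hlo z ε hcz h.1) ε hcz with h | h
      · exact absurd h hεγ
      · exact absurd h hεδ
  -- A threat in any other colour comes from a child of `v` and one of its children.
  have key₂ : ∀ ε, ε ≠ α → ε ≠ β → ∃ z, c z = some ε ∧ P.hi z = some v ∧
      (z ∈ hits p ∨ z ∈ hits q) := by
    intro ε hεα hεβ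
    have hnpar : ∀ b, P.lo v = some b ∨ P.hi v = some b → c b ≠ some ε := by
      intro b hb hcb
      rcases hpar b hb with rfl | rfl
      · exact hεα (hcol hcb hcp)
      · exact hεβ (hcol hcb hcq)
    obtain ⟨a, b, hca, hcb, h | h | h⟩ := (hT ε).cases P
    · exact absurd hca (hnpar a (Or.inl h.1))
    · exact absurd hca (hnpar a h.1)
    · have hb := hlo b ε hcb h.1
      have hab : a ≠ b := fun h' => by
        have := P.hi_lt a b h.2
        rw [h'] at this
        exact lt_irrefl _ this
      have ha : a ∉ hits v := by
        intro ha
        rcases hxy a ha with rfl | rfl <;> rcases hxy b hb with rfl | rfl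
        · exact hab rfl
        · exact hγδ ((hcol hcx hca).trans (hcol hcb hcy))
        · exact hγδ ((hcol hcx hcb).trans (hcol hca hcy))
        · exact hab rfl
      have hva := P.lo_lt_hi h.1 h.2
      have hadj := P.adj_lo_hi h.1 h.2
      have hhia : P.hi a = some v := by
        rcases (P.adj_iff v a hva).1 hadj with h' | h'
        · exact absurd (hlo a ε hca h') ha
        · exact h'
      obtain ⟨d, hd, had⟩ := hhi a ε hca hhia ha
      have hdv := (P.adj_iff d v (P.lo_lt_hi hd hhia)).1 (P.adj_lo_hi hd hhia)
      refine ⟨a, hca, hhia, ?_⟩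
      rcases hpar d hdv with rfl | rfl
      · exact Or.inl had
      · exact Or.inr had
  have hneq : ∀ {a b : V} {ε ε' : Fin 4}, c a = some ε → c b = some ε' → ε ≠ ε' → a ≠ b := by
    rintro a b ε ε' ha hb h rfl
    exact h (hcol ha hb)
  obtain ⟨z₁, hcz₁, hhz₁, -, -, hz₁⟩ := key₁ p α (Or.inl hp) hcp hαγ hαδ
  obtain ⟨z₂, hcz₂, hhz₂, hz₂v, hlz₂, hz₂⟩ := key₁ q β (Or.inr hq) hcq hβγ hβδ
  obtain ⟨z₃, hcz₃, hhz₃, hz₃⟩ := key₂ γ (Ne.symm hαγ) (Ne.symm hβγ)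
  obtain ⟨z₄, hcz₄, hhz₄, hz₄⟩ := key₂ δ (Ne.symm hαδ) (Ne.symm hβδ)
  have h34 := hneq hcz₃ hcz₄ hγδ
  have h13 := hneq hcz₁ hcz₃ hαγ
  have h14 := hneq hcz₁ hcz₄ hαδ
  have h23 := hneq hcz₂ hcz₃ hβγ
  have h24 := hneq hcz₂ hcz₄ hβδ
  -- With at most two hits on each of `p` and `q`, one of `z₃`, `z₄` joins `z₁` at `p` and the other
  -- joins `z₂` at `q`: exactly what `unsaturated` excludes.
  have finish : ∀ s ∈ hits p, s ≠ z₁ → P.hi s = some v → ∀ t ∈ hits q, t ≠ z₂ →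
      P.hi t = some v → False := by
    intro s hs hs1 hhs t ht ht2 hht
    rcases hL.unsaturated v p q z₂ β hv hp hq hlz₂ hhz₂ hz₂v hcq hcz₂ with h | h | ⟨w, hw, hwv⟩
    · exact ht2 (h t ht hht)
    · exact hαβ (hcol hcp h)
    · rcases eq_or_eq_of_card_le_two (hL.card_hits p) hz₁ hs hw (Ne.symm hs1) with rfl | rfl
      · exact hwv hhz₁
      · exact hwv hhs
  rcases hz₃ with hz₃ | hz₃ <;> rcases hz₄ with hz₄ | hz₄
  · rcases eq_or_eq_of_card_le_two (hL.card_hits p) hz₃ hz₄ hz₁ h34 with h | h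
    · exact h13 h
    · exact h14 h
  · exact finish z₃ hz₃ (Ne.symm h13) hhz₃ z₄ hz₄ (Ne.symm h24) hhz₄
  · exact finish z₄ hz₄ (Ne.symm h14) hhz₄ z₃ hz₃ (Ne.symm h23) hhz₃
  · rcases eq_or_eq_of_card_le_two (hL.card_hits q) hz₃ hz₄ hz₂ h34 with h | h
    · exact h23 h
    · exact h24 h

/-- The colour that Alice gives to a vertex `u`. -/
theorem exists_good_color (hL : P.Ledger c A hits) {u : V} (hu : c u = none) :
    ∃ γ, ¬ Threat G c u γ ∧
      (∀ v, P.hi u = some v → c v = none → ∀ q, P.lo u = some q → c q ≠ some γ) ∧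
      ∀ v p y, c v = none → P.lo v = some p → P.hi v = some u → P.lo y = some u →
        P.hi y = some v → c y = some γ →
        (∀ z ∈ hits u, P.hi z = some v → z = y) ∨ c p = some γ ∨
          ∃ w ∈ hits p, P.hi w ≠ some v := by
  have hmem : ∀ y γ, c y = some γ → P.lo y = some u → y ∈ hits u := fun y γ hy h =>
    hL.lo_mem y (hL.mem_of_colored y γ hy) u h hu
  by_cases hsat : colorsIn c (P.parents u) ∪ colorsIn c (hits u) = Finset.univ
  swap
  · obtain ⟨γ, hγ⟩ := not_forall.1 fun h => hsat (Finset.eq_univ_iff_forall.2 h)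
    rw [Finset.mem_union, not_or] at hγ
    refine ⟨γ, hL.not_threat hu hγ.1 hγ.2, fun v _ _ q hq hcq => ?_, ?_⟩
    · exact hγ.1 (mem_colorsIn.2 ⟨q, P.mem_parents.2 (Or.inl hq), hcq⟩)
    · intro v p y _ _ _ hlo _ hcy
      exact absurd (mem_colorsIn.2 ⟨y, hmem y γ hcy hlo, hcy⟩) hγ.2
  obtain ⟨a, b, x, y, α, β, γ, δ, ha, hb, hxy, hne, hnodup, hca, hcb, hcx, hcy⟩ :=
    P.exists_of_colorsIn_union_eq_univ (hL.card_hits u) hsat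
  simp only [List.nodup_cons, List.mem_cons, List.not_mem_nil, or_false, not_or,
    List.nodup_nil, and_true, not_false_eq_true] at hnodup
  obtain ⟨⟨hαβ, hαγ, hαδ⟩, ⟨hβγ, hβδ⟩, -⟩ := hnodup
  have hcol : ∀ {a : V} {ε ε' : Fin 4}, c a = some ε → c a = some ε' → ε = ε' :=
    fun h h' => Option.some.inj (h.symm.trans h')
  -- Both parents of `u` are coloured here, so this requirement is vacuous.
  have hR1 : ∀ γ v, P.hi u = some v → c v = none → ∀ q, P.lo u = some q → c q ≠ some γ := by
    intro γ v hv hcv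
    rw [Option.some.inj (hv.symm.trans hb), hcb] at hcv
    cases hcv
  -- Unless both hits of `u` have the same uncoloured higher parent `v`, any safe colour gives the
  -- first alternative.
  by_cases hcrit : ∃ v p, c v = none ∧ P.lo v = some p ∧ P.hi v = some u ∧
      P.hi x = some v ∧ P.hi y = some v
  swap
  · obtain ⟨ε, hε⟩ := hL.exists_not_threat hu
    refine ⟨ε, hε, hR1 ε, fun v p z hcv hp hv hloz hhiz hcz => Or.inl fun w hw hwv => ?_⟩
    by_contra hwz
    apply hcrit
    rcases hxy w hw with rfl | rfl <;> rcases hxy z (hmem z ε hcz hloz) with rfl | rfl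
    · exact absurd rfl hwz
    · exact ⟨v, p, hcv, hp, hv, hwv, hhiz⟩
    · exact ⟨v, p, hcv, hp, hv, hhiz, hwv⟩
    · exact absurd rfl hwz
  obtain ⟨v, p, hcv, hp, hv, hxv, hyv⟩ := hcrit
  -- Any other critical vertex would share `x` or `y`, so it is `v`.
  have huniq : ∀ v' p' z ε, P.lo v' = some p' → P.lo z = some u → P.hi z = some v' →
      c z = some ε → v' = v ∧ p' = p := by
    intro v' p' z ε hp' hloz hhiz hcz
    have : v' = v := by
      rcases hxy z (hmem z ε hcz hloz) with rfl | rfl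
      · exact Option.some.inj (hhiz.symm.trans hxv)
      · exact Option.some.inj (hhiz.symm.trans hyv)
    subst this
    exact ⟨rfl, Option.some.inj (hp'.symm.trans hp)⟩
  have hpu : p = a ∨ p = b := by
    rcases (P.adj_iff p u (P.lo_lt_hi hp hv)).1 (P.adj_lo_hi hp hv) with h | h
    · exact Or.inl (Option.some.inj (h.symm.trans ha))
    · exact Or.inr (Option.some.inj (h.symm.trans hb))
  obtain ⟨ε, hcp, hεγ, hεδ⟩ : ∃ ε, c p = some ε ∧ ε ≠ γ ∧ ε ≠ δ := by
    rcases hpu with rfl | rfl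
    · exact ⟨α, hca, hαγ, hαδ⟩
    · exact ⟨β, hcb, hβγ, hβδ⟩
  -- Repeating the colour of `p` gives the second alternative. If it is threatened, the threat
  -- exhibits a hit on `p` with higher parent `u ≠ v`, hence the third alternative for every safe
  -- colour.
  by_cases hT : Threat G c u ε
  swap
  · refine ⟨ε, hT, hR1 ε, fun v' p' z _ hp' _ hloz hhiz hcz => Or.inr (Or.inl ?_)⟩
    rw [(huniq v' p' z ε hp' hloz hhiz hcz).2, hcp]
  have hcolor : ∀ w ∈ hits u, c w ≠ some ε := by
    intro w hw hcw
    rcases hxy w hw with rfl | rfl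
    · exact hεγ (hcol hcw hcx)
    · exact hεδ (hcol hcw hcy)
  have hinj : ∀ d, P.lo u = some d ∨ P.hi u = some d → c d = some ε → d = p := by
    intro d hd hcd
    have hd' : d = a ∨ d = b := by
      rcases hd with h | h
      · exact Or.inl (Option.some.inj (h.symm.trans ha))
      · exact Or.inr (Option.some.inj (h.symm.trans hb))
    rcases hpu with rfl | rfl <;> rcases hd' with rfl | rfl
    · rfl
    · exact absurd ((hcol hca hcp).trans (hcol hcd hcb)) hαβ
    · exact absurd ((hcol hca hcd).trans (hcol hcp hcb)) hαβ
    · rfl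
  have hw : ∃ w ∈ hits p, P.hi w ≠ some v := by
    obtain ⟨d, w, hcd, hcw, h | h | h⟩ := hT.cases P
    · have h1 := hinj d (Or.inl h.1) hcd
      have h2 := hinj w (Or.inr h.2) hcw
      exact absurd (P.lo_lt_hi h.1 h.2) (by rw [h1, h2]; exact lt_irrefl _)
    · obtain ⟨hdu, hlw, hhw⟩ := h
      obtain rfl := hinj d hdu hcd
      rcases hL.hi_mem w (hL.mem_of_colored w ε hcw) u hhw hu with h | ⟨d', hd', hwd'⟩
      · exact absurd hcw (hcolor w h)
      · obtain rfl := Option.some.inj (hd'.symm.trans hlw)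
        refine ⟨w, hwd', fun h => ?_⟩
        have huv := P.hi_lt u v hv
        rw [Option.some.inj (h.symm.trans hhw)] at huv
        exact lt_irrefl _ huv
    · exact absurd hcw (hcolor w (hmem w ε hcw h.1))
  obtain ⟨η, hη⟩ := hL.exists_not_threat hu
  refine ⟨η, hη, hR1 η, fun v' p' z _ hp' _ hloz hhiz hcz => Or.inr (Or.inr ?_)⟩
  obtain ⟨rfl, rfl⟩ := huniq v' p' z η hp' hloz hhiz hcz
  exact hw

/-- An uncoloured vertex that is active, or has no uncoloured parent, may be coloured. -/
theorem update (hL : P.Ledger c A hits) {u : V} {γ : Fin 4} (hu : c u = none)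
    (hact : u ∈ A ∨ ∀ y, ¬ P.Next c u y)
    (h1 : ∀ v, P.hi u = some v → c v = none → ∀ q, P.lo u = some q → c q = some γ → u ∈ hits v)
    (h2 : ∀ v p y, c v = none → P.lo v = some p → P.hi v = some u → P.lo y = some u →
        P.hi y = some v → c y = some γ →
        (∀ z ∈ hits u, P.hi z = some v → z = y) ∨ c p = some γ ∨
          ∃ w ∈ hits p, P.hi w ≠ some v) :
    P.Ledger (Function.update c u (some γ)) (insert u A) hits := by
  have hnone : ∀ {v}, Function.update c u (some γ) v = none → v ≠ u ∧ c v = none := by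
    intro v hv
    by_cases h : v = u
    · rw [h, Function.update_self] at hv
      cases hv
    · rw [Function.update_of_ne h] at hv
      exact ⟨h, hv⟩
  refine ⟨?_, hL.card_hits, ?_, ?_, ?_⟩
  · intro x ε hx
    by_cases h : x = u
    · exact Or.inl h
    · rw [Function.update_of_ne h] at hx
      exact Or.inr (hL.mem_of_colored x ε hx)
  · intro x hx p hp hcp
    have hcp' := (hnone hcp).2
    by_cases hxA : x ∈ A
    · exact hL.lo_mem x hxA p hp hcp'
    · obtain rfl : x = u := hx.resolve_right hxA
      exact absurd hcp' (P.parents_colored_of_not_next (hact.resolve_left hxA) (Or.inl hp))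
  · intro x hx p hp hcp
    have hcp' := (hnone hcp).2
    by_cases hxA : x ∈ A
    · exact hL.hi_mem x hxA p hp hcp'
    · obtain rfl : x = u := hx.resolve_right hxA
      exact absurd hcp' (P.parents_colored_of_not_next (hact.resolve_left hxA) (Or.inr hp))
  · intro v p q y ε hcv hp hq hlo hhi hyv hcq hcy
    replace hcv := (hnone hcv).2
    have hkeep : ∀ {d η}, c d = some η → Function.update c u (some γ) d = some η := by
      intro d η hd
      rw [Function.update_of_ne, hd]
      rintro rfl
      rw [hu] at hd
      cases hd
    by_cases hqu : q = u
    · subst hqu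
      have hyq : y ≠ q := by
        rintro rfl
        exact lt_irrefl _ (P.lo_lt hlo)
      rw [Function.update_self, Option.some.injEq] at hcq
      subst hcq
      rw [Function.update_of_ne hyq] at hcy
      exact (h2 v p y hcv hp hq hlo hhi hcy).imp_right (Or.imp_left hkeep)
    rw [Function.update_of_ne hqu] at hcq
    by_cases hyu : y = u
    · subst hyu
      rw [Function.update_self, Option.some.injEq] at hcy
      subst hcy
      exact absurd (h1 v hhi hcv q hlo hcq) hyv
    rw [Function.update_of_ne hyu] at hcy
    exact (hL.unsaturated v p q y ε hcv hp hq hlo hhi hyv hcq hcy).imp_right (Or.imp_left hkeep)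

/-- A vertex may be activated if it passes on to an uncoloured parent. -/
theorem activate (hL : P.Ledger c A hits) {x z : V} (hxz : P.Next c x z)
    (hcard : (insert x (hits z)).card ≤ 2) :
    P.Ledger c (insert x A) (Function.update hits z (insert x (hits z))) := by
  have hmono : ∀ v, hits v ⊆ Function.update hits z (insert x (hits z)) v := by
    intro v
    by_cases h : v = z
    · subst h
      rw [Function.update_self]
      exact Finset.subset_insert _ _
    · rw [Function.update_of_ne h]
  have hself : x ∈ Function.update hits z (insert x (hits z)) z := by simp
  refine ⟨fun y ε hy => Or.inr (hL.mem_of_colored y ε hy), ?_, ?_, ?_, ?_⟩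
  · intro v
    by_cases h : v = z
    · subst h
      rwa [Function.update_self]
    · rw [Function.update_of_ne h]
      exact hL.card_hits v
  · rintro y (rfl | hy) p hp hcp
    · rcases hxz.2 with h | h
      · rwa [Option.some.inj (hp.symm.trans h)]
      · exact absurd hcp (h.2 p hp)
    · exact hmono p (hL.lo_mem y hy p hp hcp)
  · rintro y (rfl | hy) v hv hcv
    · rcases hxz.2 with h | h
      · exact Or.inr ⟨z, h, hself⟩
      · rw [Option.some.inj (hv.symm.trans h.1)]
        exact Or.inl hself
    · exact (hL.hi_mem y hy v hv hcv).imp (fun h => hmono v h)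
        (fun ⟨p, hp, h⟩ => ⟨p, hp, hmono p h⟩)
  · intro v p q y ε hcv hp hq hlo hhi hyv hcq hcy
    -- Only uncoloured vertices receive hits, so the hits of the coloured `q` are frozen.
    have hqz : q ≠ z := by
      rintro rfl
      rw [hxz.1] at hcq
      cases hcq
    rw [Function.update_of_ne hqz]
    exact (hL.unsaturated v p q y ε hcv hp hq hlo hhi (fun h => hyv (hmono v h)) hcq hcy).imp_right
      (Or.imp_right fun ⟨w, hw, hwv⟩ => ⟨w, hmono p hw, hwv⟩)

end Ledger

end ParentSystem

/-! ### Alice's moves: following the passes. -/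

namespace ParentSystem

variable {V : Type*} {G : SimpleGraph V} (P : ParentSystem G)

/-- The ledger is settled at `z`: no two vertices have passed on to `z`, and none has if `z` is not
active. -/
def SettledAt (A : Set V) (hits : V → Finset V) (z : V) : Prop :=
  (hits z).card ≤ 1 ∧ (z ∉ A → hits z = ∅)

/-- The colouring has a ledger that is settled at every uncoloured vertex. -/
def Settled (c : V → Option (Fin 4)) : Prop :=
  ∃ A hits, P.Ledger c A hits ∧ ∀ z, c z = none → SettledAt A hits z

variable {P}

theorem SettledAt.insert {A : Set V} {hits : V → Finset V} {z : V} (h : SettledAt A hits z)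
    (x : V) : SettledAt (insert x A) hits z :=
  ⟨h.1, fun hz => h.2 fun hzA => hz (Or.inr hzA)⟩

theorem settled_empty : P.Settled fun _ => none :=
  ⟨∅, fun _ => ∅, ⟨by simp, by simp, by simp, by simp, by simp⟩, fun _ _ => ⟨by simp, by simp⟩⟩

variable [DecidableEq V]

theorem update_eq_none {c : V → Option (Fin 4)} {u v : V} {γ : Fin 4}
    (h : Function.update c u (some γ) v = none) : v ≠ u ∧ c v = none := by
  by_cases hvu : v = u
  · rw [hvu, Function.update_self] at h
    cases h
  · rw [Function.update_of_ne hvu] at h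
    exact ⟨hvu, h⟩

/-- Starting from an uncoloured vertex `u`, Alice finds a move that settles the ledger. -/
theorem Ledger.exists_move {c : V → Option (Fin 4)} {A : Set V} {hits : V → Finset V}
    (hL : P.Ledger c A hits) {u : V} (hu : c u = none)
    (hset : ∀ z, z ≠ u → c z = none → SettledAt A hits z)
    (hcard : u ∉ A → (hits u).card ≤ 1) :
    ∃ w γ, c w = none ∧ ¬ Threat G c w γ ∧ P.Settled (Function.update c w (some γ)) := by
  induction hn : P.rank u using Nat.strong_induction_on generalizing u A hits with
  | _ n ih =>
  subst hn
  by_cases hact : u ∈ A ∨ ∀ y, ¬ P.Next c u y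
  · obtain ⟨γ, hγ, h1, h2⟩ := hL.exists_good_color hu
    refine ⟨u, γ, hu, hγ, insert u A, hits,
      hL.update hu hact (fun v hv hcv q hq hcq => absurd hcq (h1 v hv hcv q hq)) h2, ?_⟩
    intro z hz
    obtain ⟨hzu, hz⟩ := update_eq_none hz
    exact (hset z hzu hz).insert u
  · push Not at hact
    obtain ⟨huA, y, huy⟩ := hact
    have hyu : y ≠ u := by
      rintro rfl
      exact lt_irrefl _ huy.lt
    have hy := hset y hyu huy.1
    have hins := Finset.card_insert_le u (hits y)
    -- Now `u` is active with at most one hit, hence settled. The next vertex `y` has at most two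
    -- hits, and only the one from `u` if it is inactive.
    refine ih _ huy.lt (hL.activate huy (by have := hy.1; omega)) huy.1 ?_ ?_ rfl
    · intro z hzy hz
      by_cases hzu : z = u
      · subst hzu
        refine ⟨?_, fun h => absurd (Or.inl rfl) h⟩
        rw [Function.update_of_ne hzy]
        exact hcard huA
      · have hz := (hset z hzu hz).insert u
        rwa [SettledAt, Function.update_of_ne hzy]
    · intro hyA
      rw [Function.update_self, hy.2 fun h => hyA (Or.inr h)]
      simp

/-- Serves for the opening move and for the reply when Bob's vertex has no uncoloured parent: the
chain starts at an arbitrary vertex that receives no new hit. -/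
theorem Settled.exists_move {c : V → Option (Fin 4)} (h : P.Settled c) {u : V} (hu : c u = none) :
    ∃ w γ, c w = none ∧ ¬ Threat G c w γ ∧ P.Settled (Function.update c w (some γ)) := by
  obtain ⟨A, hits, hL, hset⟩ := h
  exact hL.exists_move hu (fun z _ => hset z) fun _ => (hset u hu).1

theorem Settled.exists_not_threat {c : V → Option (Fin 4)} (h : P.Settled c) {u : V}
    (hu : c u = none) : ∃ γ, ¬ Threat G c u γ := by
  obtain ⟨A, hits, hL, -⟩ := h
  exact hL.exists_not_threat hu

/-- Alice can answer every move of Bob. -/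
theorem Settled.exists_reply {c : V → Option (Fin 4)} (h : P.Settled c) {x : V} (hx : c x = none)
    (γ : Fin 4) {u : V} (hu : Function.update c x (some γ) u = none) :
    ∃ w δ, Function.update c x (some γ) w = none ∧ ¬ Threat G (Function.update c x (some γ)) w δ ∧
      P.Settled (Function.update (Function.update c x (some γ)) w (some δ)) := by
  obtain ⟨A, hits, hL, hset⟩ := h
  have hone : ∀ hits' : V → Finset V, hits' x = hits x → P.Ledger c (insert x A) hits' →
      ∀ v p y, c v = none → P.lo v = some p → P.hi v = some x → P.lo y = some x →
        P.hi y = some v → c y = some γ →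
        (∀ z ∈ hits' x, P.hi z = some v → z = y) ∨ c p = some γ ∨
          ∃ w ∈ hits' p, P.hi w ≠ some v := by
    intro hits' hx' hL' v p y _ _ _ hlo _ hcy
    have hy := hL'.lo_mem y (hL'.mem_of_colored y γ hcy) x hlo hx
    rw [hx'] at hy ⊢
    exact Or.inl fun z hz _ => Finset.card_le_one.1 (hset x hx).1 z hz y hy
  by_cases hnext : ∃ y, P.Next c x y
  · obtain ⟨y, hxy⟩ := hnext
    have hyx : y ≠ x := by
      rintro rfl
      exact lt_irrefl _ hxy.lt
    have hy := hset y hxy.1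
    have hins := Finset.card_insert_le x (hits y)
    -- Bob's vertex passes on even if already active: its earlier pass may have gone to a lower
    -- parent that is coloured by now, and `unsaturated` exempts it only if it has hit its higher
    -- parent.
    have hL₁ := hL.activate hxy (by have := hy.1; omega)
    have hL₂ := hL₁.update hx (Or.inl (Or.inl rfl)) (γ := γ) ?_
      (hone _ (Function.update_of_ne hyx.symm _ _) hL₁)
    · refine hL₂.exists_move (u := y) (by rw [Function.update_of_ne hyx]; exact hxy.1) ?_ ?_
      · intro z hzy hz
        have := ((hset z (update_eq_none hz).2).insert x).insert x
        rwa [SettledAt, Function.update_of_ne hzy]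
      · intro hyA
        rw [Function.update_self, hy.2 fun h => hyA (Or.inr (Or.inr h))]
        simp
    · intro v hv hcv q hq hcq
      rcases hxy.2 with h | h
      · rw [Option.some.inj (hq.symm.trans h), hxy.1] at hcq
        cases hcq
      · rw [Option.some.inj (hv.symm.trans h.1)]
        simp
  · push Not at hnext
    have hL₁ := hL.update hx (Or.inr hnext) (γ := γ)
      (fun v hv hcv => absurd hcv (P.parents_colored_of_not_next hnext (Or.inr hv))) ?_
    · exact Settled.exists_move ⟨_, _, hL₁, fun z hz => (hset z (update_eq_none hz).2).insert x⟩ hu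
    · intro v p y _ _ _ hlo _ hcy
      have hy := hL.lo_mem y (hL.mem_of_colored y γ hcy) x hlo hx
      exact Or.inl fun z hz _ => Finset.card_le_one.1 (hset x hx).1 z hz y hy

end ParentSystem

/-! ### From colourings to records of the game. -/

open ParentSystem

/-- The record `h` describes the partial colouring `c`. -/
def Describes {V : Type*} (h : Record V 4) (c : V → Option (Fin 4)) : Prop :=
  ∀ v α, (v, α) ∈ h ↔ c v = some α

namespace Describes

variable {V : Type*} {G : SimpleGraph V} {h : Record V 4} {c : V → Option (Fin 4)}

theorem isColored_iff (hc : Describes h c) {v : V} : IsColored h v ↔ c v ≠ none := by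
  rw [IsColored, Option.ne_none_iff_exists']
  exact exists_congr fun α => hc v α

theorem cons [DecidableEq V] (hc : Describes h c) {v : V} (hv : c v = none) (γ : Fin 4) :
    Describes ((v, γ) :: h) (Function.update c v (some γ)) := by
  intro w α
  rw [List.mem_cons, hc w α, Prod.mk.injEq]
  by_cases hwv : w = v
  · subst hwv
    rw [Function.update_self, hv]
    simp [eq_comm]
  · rw [Function.update_of_ne hwv]
    simp [hwv]

theorem isLegal (hc : Describes h c) (hmono : ¬ HasMonochromaticClique G 2 h) {v : V}
    (hv : c v = none) {γ : Fin 4} (hγ : ¬ Threat G c v γ) : IsLegal G 2 h (v, γ) := by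
  refine ⟨fun hcol => hc.isColored_iff.1 hcol hv, ?_⟩
  rintro ⟨α, s, hs, hsα⟩
  by_cases hvs : v ∈ s
  · have hα : α = γ := by
      rcases List.mem_cons.1 (hsα v hvs) with h' | h'
      · exact (Prod.mk.inj h').2
      · rw [hc, hv] at h'
        cases h'
    subst hα
    have hcol : ∀ w ∈ s, w ≠ v → c w = some α := by
      intro w hw hwv
      rcases List.mem_cons.1 (hsα w hw) with h' | h'
      · exact absurd (Prod.mk.inj h').1 hwv
      · exact (hc w α).1 h'
    classical
    obtain ⟨a, b, hab, he⟩ := Finset.card_eq_two.1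
      (by rw [Finset.card_erase_of_mem hvs, hs.card_eq] : (s.erase v).card = 2)
    have ha := Finset.mem_erase.1 (by simp [he] : a ∈ s.erase v)
    have hb := Finset.mem_erase.1 (by simp [he] : b ∈ s.erase v)
    exact hγ ⟨a, b, hs.isClique ha.2 hb.2 hab, hs.isClique ha.2 hvs ha.1,
      hs.isClique hb.2 hvs hb.1, hcol a ha.2 ha.1, hcol b hb.2 hb.1⟩
  · refine hmono ⟨α, s, hs, fun w hw => (List.mem_cons.1 (hsα w hw)).resolve_left fun h' => ?_⟩
    exact hvs ((Prod.mk.inj h').1 ▸ hw)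

end Describes

theorem not_hasMonochromaticClique_nil {V : Type*} (G : SimpleGraph V) (k n : ℕ) :
    ¬ HasMonochromaticClique G k ([] : Record V n) := by
  rintro ⟨α, s, hs, h⟩
  obtain ⟨v, hv⟩ := Finset.card_pos.1 (by rw [hs.card_eq]; omega : 0 < s.card)
  exact List.not_mem_nil (h v hv)

/-- If every vertex has at most two lower neighbours and these are adjacent, Alice wins the
`2`-clique-relaxed game with four colours. -/
theorem ParentSystem.aliceWins {V : Type*} {G : SimpleGraph V} (P : ParentSystem G) :
    AliceWins G 2 4 := by
  classical
  let Good : Record V 4 → Prop := fun h => ∃ c, Describes h c ∧ P.Settled c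
  -- Any legal move that restores a settled ledger will do; the chain of passes is only needed to
  -- show that one exists.
  let σ : Strategy V 4 := fun h =>
    if hm : ∃ m, IsLegal G 2 h m ∧ Good (m :: h) then some hm.choose else none
  have hσ : ∀ h m, σ h = some m → IsLegal G 2 h m ∧ Good (m :: h) := by
    intro h m hm
    dsimp only [σ] at hm
    split_ifs at hm with hex
    rw [← Option.some.inj hm]
    exact hex.choose_spec
  have hplay : ∀ h, IsPlay G 2 σ h → ¬ HasMonochromaticClique G 2 h ∧ (Odd h.length → Good h) ∧
      (Even h.length → ∀ v, ¬ IsColored h v → ∃ m, IsLegal G 2 h m ∧ Good (m :: h)) := by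
    intro h hh
    induction hh with
    | start =>
      refine ⟨not_hasMonochromaticClique_nil G 2 4, by simp, fun _ v _ => ?_⟩
      have hc : Describes ([] : Record V 4) (fun _ => none) := fun _ _ => by simp
      obtain ⟨w, γ, hw, hγ, hset⟩ := (settled_empty (P := P)).exists_move (u := v) rfl
      exact ⟨(w, γ), hc.isLegal (not_hasMonochromaticClique_nil G 2 4) hw hγ, _, hc.cons hw γ, hset⟩
    | @alice h m _ heven hm hlegal _ =>
      refine ⟨hlegal.2, fun _ => (hσ h m hm).2, fun h' => ?_⟩
      rw [List.length_cons, Nat.even_add_one] at h'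
      exact absurd heven h'
    | @bob h m _ hodd hlegal ih =>
      refine ⟨hlegal.2, fun h' => ?_, fun _ v hv => ?_⟩
      · rw [List.length_cons, Nat.odd_add_one] at h'
        exact absurd hodd h'
      · obtain ⟨x, γ⟩ := m
        obtain ⟨c, hc, hset⟩ := ih.2.1 hodd
        have hx : c x = none := by
          by_contra hne
          exact hlegal.1 (hc.isColored_iff.2 hne)
        have hc' := hc.cons hx γ
        have hv' : Function.update c x (some γ) v = none := by
          by_contra hne
          exact hv (hc'.isColored_iff.2 hne)
        obtain ⟨w, δ, hw, hδ, hset'⟩ := hset.exists_reply hx γ hv'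
        exact ⟨(w, δ), hc'.isLegal hlegal.2 hw hδ, _, hc'.cons hw δ, hset'⟩
  refine ⟨σ, fun h hh hstuck v => ?_⟩
  by_contra hv
  obtain ⟨hmono, hodd, heven⟩ := hplay h hh
  rcases Nat.even_or_odd h.length with hlen | hlen
  · have hex := heven hlen v hv
    have hm : σ h = some hex.choose := dif_pos hex
    exact hstuck _ (.alice hh hlen hm hex.choose_spec.1)
  -- Alice also loses if Bob is stuck, so a safe colour is needed at an uncoloured vertex on his
  -- turn too.
  · obtain ⟨c, hc, hset⟩ := hodd hlen
    have hv' : c v = none := by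
      by_contra hne
      exact hv (hc.isColored_iff.2 hne)
    obtain ⟨γ, hγ⟩ := hset.exists_not_threat hv'
    exact hstuck _ (.bob hh hlen (hc.isLegal hmono hv' hγ))

end CliqueRelaxedGame

theorem mainTheorem4 {V : Type*} [Finite V] (H : SimpleGraph V)
    (hchordal : CliqueRelaxedGame.IsChordal H) (hclique : H.cliqueNum = 3) :
    CliqueRelaxedGame.gameChromaticNumber H 2 ≤ 4 := by
  obtain ⟨P⟩ := hchordal.nonempty_parentSystem hclique.le
  exact iInf₂_le (4 : ℕ) P.aliceWins
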